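/- Let $0<T\le\infty$, let $\Omega=\mathbb R$, $\Omega_-=(-\infty,0)$, $\Omega_+=(0,\infty)$, and let $\mu_-,\mu_+\ge 0$. For an open set $O\subset\mathbb R$, a bounded coefficient $m\ge0$ on $O$ and data $(\eta_0,u_0)$, a *solution* $W=(\eta,u)$ of $$\partial_t\eta+\partial_x u=0,\qquad \partial_t\bigl(u-m\,\partial_x^2u\bigr)+\partial_x\eta=0\quad\text{in } O\times(0,T),\qquad W(\cdot,0)=(\eta_0,u_0)\quad\text{in } O,$$ is a pair of real functions with $\eta,u\in C([0,T);L^2(O))$ and $u\in L^2(0,T';H^2(O))$ for every real $T'<T$ that satisfies both equations in the sense of distributions on $O\times(0,T)$ and takes the initial values. The operator with constant $m=\mu^2$ is the linear Saint-Venant operator if $\mu=0$ and the linear Boussinesq operator if $\mu>0$; no boundary condition is imposed. **Theorem.** Let $W=(\eta,u)$ be a solution of the hybrid problem, that is, of the problem above on $O=\mathbb R$ with $m=\mu_-^2$ in $\Omega_-$ and $m=\mu_+^2$ in $\Omega_+$, and let $W_\pm=(\eta_\pm,u_\pm)$ be solutions of the problem on $O=\Omega_\pm$ with $m=\mu_\pm^2$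 and with the same initial data restricted to $\Omega_\pm$. Let $u_\pm(0,\cdot)$ and $\partial_xu_\pm(0,\cdot)$ be the traces at $x=0$, defined for almost every $t\in(0,T)$ since $u_\pm(\cdot,t)\in H^2(\Omega_\pm)$, and suppose that the Laplace transforms of these four functions of $t\in(0,T)$ (extended by $0$ beyond $T$ if $T<\infty$) exist, i.e. converge absolutely in some right half-plane. Then $$W_-=W|_{\Omega_-\times[0,T)}\quad\text{and}\quad W_+=W|_{\Omega_+\times[0,T)}$$ if and only if $$u_-(0,t)=u_+(0,t)\quad\text{and}\quad \partial_xu_-(0,t)=\partial_xu_+(0,t)\qquad\text{for almost every } t\in(0,T).$$ (Equality with the restrictions means equality in $L^2(\Omega_\pm)$ for every $t\in[0,T)$.) -/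

import Mathlib

open MeasureTheory Set
open scoped ContDiff

noncomputable section

/-- The open time interval `]0, T[`, where `T` may be `∞`. -/
def timeInterval (T : EReal) : Set ℝ := {t : ℝ | 0 < t ∧ (t : EReal) < T}

/-- The half-open time interval `[0, T[`, where `T` may be `∞`. -/
def timeIntervalZero (T : EReal) : Set ℝ := {t : ℝ | 0 ≤ t ∧ (t : EReal) < T}

/-- The space `L²(Ω)` of real functions on a subset `Ω` of the line. -/
abbrev L2 (Ω : Set ℝ) := Lp ℝ 2 (volume.restrict Ω)

/-- `ψ ∈ C_c^∞(Ω)`. -/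
def IsTestFunction (Ω : Set ℝ) (ψ : ℝ → ℝ) : Prop :=
  ContDiff ℝ ∞ ψ ∧ HasCompactSupport ψ ∧ tsupport ψ ⊆ Ω

/-- `g` is the weak derivative of `f` on `Ω`. -/
def HasWeakDeriv (Ω : Set ℝ) (f g : ℝ → ℝ) : Prop :=
  ∀ ψ : ℝ → ℝ, IsTestFunction Ω ψ →
    ∫ x in Ω, f x * deriv ψ x = -∫ x in Ω, g x * ψ x

/-- `u ∈ L²(0, T'; H²(Ω))` for every real `T' < T`; the functions `ux t` and
`uxx t` are the first and the second weak space derivative of `u t`, for almost every `t`. -/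
structure IsL2LocH2 (Ω : Set ℝ) (T : EReal) (u ux uxx : ℝ → L2 Ω) : Prop where
  memLp_u : ∀ T' : ℝ, (T' : EReal) < T → MemLp u 2 (volume.restrict (Ioo 0 T'))
  memLp_ux : ∀ T' : ℝ, (T' : EReal) < T → MemLp ux 2 (volume.restrict (Ioo 0 T'))
  memLp_uxx : ∀ T' : ℝ, (T' : EReal) < T → MemLp uxx 2 (volume.restrict (Ioo 0 T'))
  weakDeriv_u : ∀ᵐ t ∂(volume.restrict (timeInterval T)), HasWeakDeriv Ω (u t) (ux t)
  weakDeriv_ux : ∀ᵐ t ∂(volume.restrict (timeInterval T)), HasWeakDeriv Ω (ux t) (uxx t)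

/-- `W = (η, u)` is a solution of the problem

  `∂ₜ η + ∂ₓ u = 0`,  `∂ₜ (u - m(x) ∂ₓ² u) + ∂ₓ η = 0`  in `Ω × ]0, T[`,
  `(η, u)(·, 0) = (η₀, u₀)`  in `Ω`,

with `η, u ∈ C([0, T[; L²(Ω))` and `u ∈ L²_loc([0, T[; H²(Ω))`. The two equations hold in the
sense of distributions on `Ω × ]0, T[`, tested against the products `θ(t) ψ(x)`, whose span is
dense. The coefficient `m = 0` gives the Saint-Venant operator and a constant `m = μ² > 0` the
Boussinesq operator. No boundary condition is imposed. -/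
def IsSolution (Ω : Set ℝ) (m : ℝ → ℝ) (T : EReal) (η₀ u₀ : ℝ → ℝ) (η u : ℝ → L2 Ω) : Prop :=
  ContinuousOn η (timeIntervalZero T) ∧
  ContinuousOn u (timeIntervalZero T) ∧
  (η 0 =ᵐ[volume.restrict Ω] η₀) ∧
  (u 0 =ᵐ[volume.restrict Ω] u₀) ∧
  ∃ ux uxx : ℝ → L2 Ω,
    IsL2LocH2 Ω T u ux uxx ∧
    ∀ θ ψ : ℝ → ℝ, IsTestFunction (timeInterval T) θ → IsTestFunction Ω ψ →
      (∫ t in timeInterval T, deriv θ t * ∫ x in Ω, η t x * ψ x)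
        + (∫ t in timeInterval T, θ t * ∫ x in Ω, u t x * deriv ψ x) = 0 ∧
      (∫ t in timeInterval T, deriv θ t * ∫ x in Ω, (u t x - m x * uxx t x) * ψ x)
        + (∫ t in timeInterval T, θ t * ∫ x in Ω, η t x * deriv ψ x) = 0

/-- The homogeneous problem with parameter `μ` (Saint-Venant for `μ = 0`, Boussinesq for `μ > 0`)
in `Ω`, for instance in a half-line. -/
def IsHomogeneousSolution (Ω : Set ℝ) (μ : ℝ) (T : EReal) (η₀ u₀ : ℝ → ℝ)
    (η u : ℝ → L2 Ω) : Prop :=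
  IsSolution Ω (fun _ => μ ^ 2) T η₀ u₀ η u

/-- The hybrid (heterogeneous Cauchy) problem on the whole line: the operator is the one with
parameter `μm` in `x < 0` and the one with parameter `μp` in `x > 0`. -/
def IsHybridSolution (μm μp : ℝ) (T : EReal) (η₀ u₀ : ℝ → ℝ)
    (η u : ℝ → L2 (univ : Set ℝ)) : Prop :=
  IsSolution univ (fun x => if x < 0 then μm ^ 2 else μp ^ 2) T η₀ u₀ η u

/-- `a = f(0)` and `b = ∂ₓ f(0)` for a function `f` on a half-line `Ω` ending at `0`, known up to
null sets: on `Ω` the function `f` agrees almost everywhere with a `C¹` function `F` such that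
`F(0) = a` and `F'(0) = b`. Every `f ∈ H²(Ω)` has exactly one such pair. -/
def HasInterfaceTraces (Ω : Set ℝ) (f : ℝ → ℝ) (a b : ℝ) : Prop :=
  ∃ F : ℝ → ℝ, ContDiff ℝ 1 F ∧ f =ᵐ[volume.restrict Ω] F ∧ F 0 = a ∧ deriv F 0 = b

/-- The Laplace transform `s ↦ ∫ e^{-st} g(t) dt` of a function `g` on `]0, T[` (extended by zero
if `T` is finite) exists, as an absolutely convergent integral, in some right half-plane. -/
def HasLaplaceTransform (T : EReal) (g : ℝ → ℝ) : Prop :=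
  ∃ σ : ℝ, ∀ s : ℂ, σ < s.re →
    IntegrableOn (fun t : ℝ => Complex.exp (-s * t) * (g t : ℂ)) (timeInterval T)

end

/-! The hybrid solution restricted to either half-line solves the homogeneous problem there.
Moreover its velocity `u t` lies in H²(ℝ) for almost every `t`, so it is C¹ and has the same two
traces at 0 from both sides. If the half-line solutions are the restrictions, their traces therefore
agree. Conversely, if their traces agree, so do those of the differences `w = u_± - u`, and it
remains to show that these differences vanish.

This is an energy argument. With zero data and `c = μ²`, integration in time gives `e = -∫₀ᵗ wₓ` and
`w = c wₓₓ + ∫₀ᵗ∫₀ˢ wₓₓ`. Put `E(s) = ‖∫₀ˢ wₓ‖² + c ‖∫₀ˢ wₓₓ‖² + ‖∫₀ˢ∫₀ʳ wₓₓ‖²`. Pairing the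
identity for `w` with `∫₀ˢ wₓₓ` yields `E'(s) = 2 ∫₀ˢ ∫_Ω ∂ₓ(wₓ(r) w(s)) dx dr`. The inner integral
is the product of the trace of `wₓ` at time `r` and that of `w` at time `s`, with sign `+` on the
left half-line and `-` on the right. Thus equal traces make the two fluxes cancel. The total energy
is absolutely continuous, starts at 0 and has zero derivative almost everywhere, so it vanishes, and
with it `e` and `w`.

The main steps are `velocity_eq_of_tested`, the two lemmas `inner_add_inner_eq_of_primitives_*`,
`ae_hasDerivAt_energy` and `eq_zero_of_traces_eq`. -/

/-! ### Test functions, weak derivatives and the du Bois-Reymond lemma -/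

namespace IsTestFunction

variable {Ω Ω' : Set ℝ} {ψ φ : ℝ → ℝ}

theorem contDiff (h : IsTestFunction Ω ψ) : ContDiff ℝ ∞ ψ := h.1

theorem hasCompactSupport (h : IsTestFunction Ω ψ) : HasCompactSupport ψ := h.2.1

theorem continuous (h : IsTestFunction Ω ψ) : Continuous ψ := h.1.continuous

theorem mono (h : IsTestFunction Ω ψ) (hΩ : Ω ⊆ Ω') : IsTestFunction Ω' ψ :=
  ⟨h.1, h.2.1, h.2.2.trans hΩ⟩

theorem eq_zero_of_notMem (h : IsTestFunction Ω ψ) {x : ℝ} (hx : x ∉ Ω) : ψ x = 0 :=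
  image_eq_zero_of_notMem_tsupport fun hx' => hx (h.2.2 hx')

theorem deriv (h : IsTestFunction Ω ψ) : IsTestFunction Ω (deriv ψ) :=
  ⟨(contDiff_infty_iff_deriv.1 h.1).2, h.2.1.deriv,
    (closure_minimal support_deriv_subset (isClosed_tsupport ψ)).trans h.2.2⟩

theorem sub (h : IsTestFunction Ω ψ) (h' : IsTestFunction Ω φ) :
    IsTestFunction Ω (fun x => ψ x - φ x) :=
  ⟨h.1.sub h'.1, h.2.1.sub h'.2.1, (tsupport_sub ψ φ).trans (union_subset h.2.2 h'.2.2)⟩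

theorem const_mul (c : ℝ) (h : IsTestFunction Ω ψ) : IsTestFunction Ω (fun x => c * ψ x) :=
  ⟨contDiff_const.mul h.1, h.2.1.mul_left,
    (tsupport_mul_subset_right (f := fun _ => c)).trans h.2.2⟩

theorem memLp (h : IsTestFunction Ω ψ) (μ : Measure ℝ) [IsFiniteMeasureOnCompacts μ] :
    MemLp ψ 2 μ :=
  h.continuous.memLp_of_hasCompactSupport h.hasCompactSupport

theorem integrable (h : IsTestFunction Ω ψ) : Integrable ψ :=
  h.continuous.integrable_of_hasCompactSupport h.hasCompactSupport

/-- The product with a test function is integrable as soon as the other factor is locally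
integrable. -/
theorem integrable_mul (h : IsTestFunction Ω ψ) {f : ℝ → ℝ} (hf : LocallyIntegrable f) :
    Integrable (fun x => f x * ψ x) := by
  simpa [mul_comm] using
    hf.integrable_smul_left_of_hasCompactSupport h.continuous h.hasCompactSupport

theorem setIntegral_mul (h : IsTestFunction Ω ψ) (f : ℝ → ℝ) :
    ∫ x in Ω, f x * ψ x = ∫ x, f x * ψ x :=
  setIntegral_eq_integral_of_forall_compl_eq_zero fun x hx => by
    simp [h.eq_zero_of_notMem hx]

theorem setIntegral_mul_indicator (h : IsTestFunction Ω ψ) (f : ℝ → ℝ) :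
    ∫ x in Ω, f x * ψ x = ∫ x, Ω.indicator f x * ψ x := by
  rw [h.setIntegral_mul]
  congr 1 with x
  by_cases hx : x ∈ Ω
  · simp [hx]
  · simp [h.eq_zero_of_notMem hx]

theorem setIntegral_mul_of_subset (h : IsTestFunction Ω ψ) (hΩ : Ω ⊆ Ω') (f : ℝ → ℝ) :
    ∫ x in Ω', f x * ψ x = ∫ x in Ω, f x * ψ x := by
  rw [h.setIntegral_mul, (h.mono hΩ).setIntegral_mul]

end IsTestFunction

theorem HasWeakDeriv.mono {Ω Ω' : Set ℝ} {f g : ℝ → ℝ} (h : HasWeakDeriv Ω' f g) (hΩ : Ω ⊆ Ω') :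
    HasWeakDeriv Ω f g := fun ψ hψ => by
  rw [← hψ.deriv.setIntegral_mul_of_subset hΩ, ← hψ.setIntegral_mul_of_subset hΩ]
  exact h ψ (hψ.mono hΩ)

theorem HasWeakDeriv.congr {Ω : Set ℝ} {f g f' g' : ℝ → ℝ} (h : HasWeakDeriv Ω f g)
    (hf : f =ᵐ[volume.restrict Ω] f') (hg : g =ᵐ[volume.restrict Ω] g') :
    HasWeakDeriv Ω f' g' := fun ψ hψ => by
  have h1 : ∫ x in Ω, f' x * deriv ψ x = ∫ x in Ω, f x * deriv ψ x :=
    integral_congr_ae (by filter_upwards [hf] with x hx; rw [hx])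
  have h2 : ∫ x in Ω, g' x * ψ x = ∫ x in Ω, g x * ψ x :=
    integral_congr_ae (by filter_upwards [hg] with x hx; rw [hx])
  rw [h1, h2, h ψ hψ]

/-- A test function with vanishing integral is the derivative of a test function. -/
theorem exists_testFunction_primitive {Ω : Set ℝ} (hΩ : Ω.OrdConnected) {ψ : ℝ → ℝ}
    (h : IsTestFunction Ω ψ) (h0 : ∫ x, ψ x = 0) :
    ∃ Ψ, IsTestFunction Ω Ψ ∧ deriv Ψ = ψ := by
  rcases (tsupport ψ).eq_empty_or_nonempty with he | hne
  · have hψ : ψ = 0 := tsupport_eq_empty_iff.1 he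
    refine ⟨0, ⟨contDiff_const, HasCompactSupport.zero, by simp⟩, ?_⟩
    rw [hψ]
    ext x
    simp
  obtain ⟨a, ha, hal⟩ := h.hasCompactSupport.isCompact.exists_isLeast hne
  obtain ⟨b, hb, hbg⟩ := h.hasCompactSupport.isCompact.exists_isGreatest hne
  have hz : ∀ x, x ∉ Icc a b → ψ x = 0 := fun x hx =>
    image_eq_zero_of_notMem_tsupport fun hx' => hx ⟨hal hx', hbg hx'⟩
  have hd : ∀ x, HasDerivAt (fun y => ∫ t in a..y, ψ t) (ψ x) x := fun x =>
    intervalIntegral.integral_hasDerivAt_right (h.continuous.intervalIntegrable _ _)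
      h.continuous.aestronglyMeasurable.stronglyMeasurableAtFilter h.continuous.continuousAt
  have hderiv : deriv (fun y => ∫ t in a..y, ψ t) = ψ := funext fun x => (hd x).deriv
  have hsupp : Function.support (fun y => ∫ t in a..y, ψ t) ⊆ Icc a b := by
    intro y hy
    by_contra hyn
    apply hy
    rcases lt_or_ge y a with hya | hya
    · show ∫ t in a..y, ψ t = 0
      rw [intervalIntegral.integral_symm, intervalIntegral.integral_of_le hya.le,
        integral_Ioc_eq_integral_Ioo, setIntegral_eq_zero_of_forall_eq_zero, neg_zero]
      exact fun x hx => hz x fun hx' => absurd hx.2 (not_lt.2 hx'.1)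
    -- To the right of the support the primitive is the total integral, which is 0 by `h0`.
    · have hyb : b < y := by
        by_contra hc
        exact hyn ⟨hya, not_lt.1 hc⟩
      show ∫ t in a..y, ψ t = 0
      rw [intervalIntegral.integral_of_le hya, ← integral_Icc_eq_integral_Ioc,
        setIntegral_eq_integral_of_forall_compl_eq_zero, h0]
      exact fun x hx => hz x fun hx' => hx ⟨hx'.1, hx'.2.trans hyb.le⟩
  have hts : tsupport (fun y => ∫ t in a..y, ψ t) ⊆ Icc a b := closure_minimal hsupp isClosed_Icc
  refine ⟨_, ⟨?_, ?_, hts.trans (hΩ.out (h.2.2 ha) (h.2.2 hb))⟩, hderiv⟩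
  · rw [contDiff_infty_iff_deriv, hderiv]
    exact ⟨fun x => (hd x).differentiableAt, h.1⟩
  · exact HasCompactSupport.of_support_subset_isCompact isCompact_Icc hsupp

theorem exists_testFunction_integral_eq_one {Ω : Set ℝ} (hΩ : IsOpen Ω) (hne : Ω.Nonempty) :
    ∃ ψ, IsTestFunction Ω ψ ∧ ∫ x, ψ x = 1 := by
  obtain ⟨x, hx⟩ := hne
  obtain ⟨f, hf1, hf2, hf3, hf4, hf5⟩ :=
    exists_contDiff_tsupport_subset (n := ⊤) (hΩ.mem_nhds hx)
  have hf : IsTestFunction Ω f := ⟨hf3, hf2, hf1⟩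
  have hpos : 0 < ∫ x, f x :=
    hf.continuous.integral_pos_of_hasCompactSupport_nonneg_nonzero hf2
      (fun y => (hf4 (mem_range_self y)).1) (x := x) (by rw [hf5]; exact one_ne_zero)
  refine ⟨_, hf.const_mul (∫ x, f x)⁻¹, ?_⟩
  rw [integral_const_mul, inv_mul_cancel₀ hpos.ne']

/-- A function orthogonal to all test functions vanishes. -/
theorem ae_eq_zero_of_forall_testFunction {Ω : Set ℝ} (hΩ : IsOpen Ω) {f : ℝ → ℝ}
    (hf : LocallyIntegrableOn f Ω) (h : ∀ ψ, IsTestFunction Ω ψ → ∫ x in Ω, f x * ψ x = 0) :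
    f =ᵐ[volume.restrict Ω] 0 := by
  rw [Filter.EventuallyEq, ae_restrict_iff' hΩ.measurableSet]
  refine hΩ.ae_eq_zero_of_integral_contDiff_smul_eq_zero hf fun g h1 h2 h3 => ?_
  have hg : IsTestFunction Ω g := ⟨h1, h2, h3⟩
  rw [← h g hg, hg.setIntegral_mul]
  simp [mul_comm]

/-- **Du Bois-Reymond lemma**: a function with vanishing weak derivative on an open interval is
constant. -/
theorem exists_ae_eq_const_of_hasWeakDeriv_zero {Ω : Set ℝ} (hΩ : IsOpen Ω)
    (hc : Ω.OrdConnected) {f : ℝ → ℝ} (hf : LocallyIntegrable f)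
    (h : HasWeakDeriv Ω f 0) : ∃ c : ℝ, f =ᵐ[volume.restrict Ω] fun _ => c := by
  rcases Ω.eq_empty_or_nonempty with rfl | hne
  · exact ⟨0, by simp [Filter.EventuallyEq]⟩
  obtain ⟨ψ₀, hψ₀, h1⟩ := exists_testFunction_integral_eq_one hΩ hne
  refine ⟨∫ x, f x * ψ₀ x, ?_⟩
  set c := ∫ x, f x * ψ₀ x
  have key : (fun x => f x - c) =ᵐ[volume.restrict Ω] 0 := by
    refine ae_eq_zero_of_forall_testFunction hΩ
      ((hf.sub (continuous_const.locallyIntegrable)).locallyIntegrableOn Ω) fun ψ hψ => ?_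
    -- Subtracting a multiple of the normalized `ψ₀` leaves mean zero, hence the derivative of a
    -- test function, to which `f` is orthogonal.
    have hi0 : ∫ x, (ψ x - (∫ y, ψ y) * ψ₀ x) = 0 := by
      rw [integral_sub hψ.integrable (hψ₀.integrable.const_mul _), integral_const_mul, h1]
      ring
    obtain ⟨Ψ, hΨ, hd⟩ := exists_testFunction_primitive hc (hψ.sub (hψ₀.const_mul (∫ y, ψ y))) hi0
    have h2 := h Ψ hΨ
    rw [hd, (hψ.sub (hψ₀.const_mul (∫ y, ψ y))).setIntegral_mul] at h2
    have h3 : ∫ x, f x * (ψ x - (∫ y, ψ y) * ψ₀ x)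
        = (∫ x, f x * ψ x) - (∫ y, ψ y) * c := by
      rw [← integral_const_mul, ← integral_sub (hψ.integrable_mul hf)
        ((hψ₀.integrable_mul hf).const_mul _)]
      congr 1 with x
      ring
    rw [h3] at h2
    rw [hψ.setIntegral_mul]
    simp only [sub_mul]
    rw [integral_sub (hψ.integrable_mul hf) (hψ.integrable.const_mul _), integral_const_mul]
    simp only [Pi.zero_apply, zero_mul, integral_zero, neg_zero] at h2
    linarith
  filter_upwards [key] with x hx
  simpa [sub_eq_zero] using hx

/-! ### Primitives of locally integrable functions -/

theorem locallyIntegrable_intervalIntegrable {E : Type*} [NormedAddCommGroup E]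
    {g : ℝ → E} (hg : LocallyIntegrable g) (a b : ℝ) : IntervalIntegrable g volume a b :=
  (hg.integrableOn_isCompact isCompact_uIcc).intervalIntegrable

theorem absolutelyContinuousOnInterval_primitive {g : ℝ → ℝ} (hg : LocallyIntegrable g)
    (c a b : ℝ) : AbsolutelyContinuousOnInterval (fun x => c + ∫ t in (0 : ℝ)..x, g t) a b := by
  -- The interval is enlarged to contain the base point 0 of the primitive.
  have h1 : AbsolutelyContinuousOnInterval (fun x => ∫ t in (0 : ℝ)..x, g t)
      (min 0 (min a b)) (max 0 (max a b)) :=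
    (locallyIntegrable_intervalIntegrable hg _ _).absolutelyContinuousOnInterval_intervalIntegral
      (by rw [uIcc_of_le (by simp)]; simp)
  have h2 := h1.mono (c := a) (d := b) (by
    rw [uIcc_of_le (show min 0 (min a b) ≤ max 0 (max a b) by simp)]
    exact Icc_subset_Icc (min_le_right _ _) (le_max_right _ _))
  exact (contDiff_const.contDiffOn.absolutelyContinuousOnInterval).add h2

theorem ae_deriv_primitive {g : ℝ → ℝ} (hg : LocallyIntegrable g) (c : ℝ) :
    deriv (fun x => c + ∫ t in (0 : ℝ)..x, g t) =ᵐ[volume] g := by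
  filter_upwards [_root_.LocallyIntegrable.ae_hasDerivAt_integral hg] with x hx
  exact ((hx 0).const_add c).deriv

theorem continuous_primitive_const_add {g : ℝ → ℝ} (hg : LocallyIntegrable g) (c : ℝ) :
    Continuous (fun x => c + ∫ t in (0 : ℝ)..x, g t) :=
  continuous_const.add
    (intervalIntegral.continuous_primitive (locallyIntegrable_intervalIntegrable hg) 0)

/-- Integration by parts for primitives of locally integrable functions. -/
theorem integral_primitive_mul_primitive {p q : ℝ → ℝ} (hp : LocallyIntegrable p)
    (hq : LocallyIntegrable q) (P₀ Q₀ a b : ℝ) :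
    ∫ x in a..b, (p x * (Q₀ + ∫ t in (0 : ℝ)..x, q t) + (P₀ + ∫ t in (0 : ℝ)..x, p t) * q x) =
      (P₀ + ∫ t in (0 : ℝ)..b, p t) * (Q₀ + ∫ t in (0 : ℝ)..b, q t)
        - (P₀ + ∫ t in (0 : ℝ)..a, p t) * (Q₀ + ∫ t in (0 : ℝ)..a, q t) := by
  rw [← (absolutelyContinuousOnInterval_primitive hp P₀ a b).integral_deriv_mul_eq_sub
    (absolutelyContinuousOnInterval_primitive hq Q₀ a b)]
  refine intervalIntegral.integral_congr_ae ?_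
  filter_upwards [ae_deriv_primitive hp P₀, ae_deriv_primitive hq Q₀] with x h1 h2 _
  rw [h1, h2]

theorem hasWeakDeriv_primitive {g : ℝ → ℝ} (hg : LocallyIntegrable g) (c : ℝ) :
    HasWeakDeriv univ (fun x => c + ∫ t in (0 : ℝ)..x, g t) g := by
  intro ψ hψ
  obtain ⟨R, hR⟩ := hψ.hasCompactSupport.isCompact.isBounded.subset_closedBall 0
  rw [Real.closedBall_eq_Icc, zero_sub, zero_add] at hR
  -- Strictly larger than `R`, so that `ψ` vanishes at `±r` and the boundary terms drop out.
  set r := max R 0 + 1 with hr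
  have hRr : R < r := by rw [hr]; linarith [le_max_left R 0]
  have hr0 : 0 < r := by rw [hr]; linarith [le_max_right R 0]
  have hz : ∀ x, x ∉ Icc (-R) R → ψ x = 0 := fun x hx =>
    image_eq_zero_of_notMem_tsupport fun h => hx (hR h)
  have hz' : ∀ x, x ∉ Icc (-R) R → deriv ψ x = 0 := fun x hx =>
    image_eq_zero_of_notMem_tsupport fun h =>
      hx (hR (closure_minimal support_deriv_subset (isClosed_tsupport ψ) h))
  have hsub : Icc (-R) R ⊆ Ioc (-r) r := fun x hx => ⟨by linarith [hx.1], by linarith [hx.2]⟩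
  have hAC : AbsolutelyContinuousOnInterval ψ (-r) r :=
    (hψ.contDiff.of_le (by simp)).contDiffOn.absolutelyContinuousOnInterval
  have h := (absolutelyContinuousOnInterval_primitive hg c (-r) r).integral_mul_deriv_eq_deriv_mul
    hAC
  rw [hz r fun h => by linarith [h.2], hz (-r) fun h => by linarith [h.1], mul_zero, mul_zero,
    sub_zero, zero_sub, intervalIntegral.integral_eq_integral_of_support_subset,
    intervalIntegral.integral_eq_integral_of_support_subset] at h
  · rw [setIntegral_univ, setIntegral_univ, h]
    congr 1
    refine integral_congr_ae ?_
    filter_upwards [ae_deriv_primitive hg c] with x hx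
    rw [hx]
  · exact fun x hx => hsub (by by_contra hc; exact hx (by simp [hz x hc]))
  · exact fun x hx => hsub (by by_contra hc; exact hx (by simp [hz' x hc]))

/-- A function with a weak derivative on an open interval is a primitive of it. -/
theorem HasWeakDeriv.exists_ae_eq_primitive {Ω : Set ℝ} (hΩ : IsOpen Ω) (hc : Ω.OrdConnected)
    {f g : ℝ → ℝ} (hf : LocallyIntegrable (Ω.indicator f))
    (hg : LocallyIntegrable (Ω.indicator g)) (h : HasWeakDeriv Ω f g) :
    ∃ c : ℝ, f =ᵐ[volume.restrict Ω] fun x => c + ∫ t in (0 : ℝ)..x, Ω.indicator g t := by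
  have hP := (hasWeakDeriv_primitive hg 0).mono (subset_univ Ω)
  set P := fun x => 0 + ∫ t in (0 : ℝ)..x, Ω.indicator g t with hPdef
  have hPl : LocallyIntegrable P := (continuous_primitive_const_add hg 0).locallyIntegrable
  obtain ⟨c, hcc⟩ := exists_ae_eq_const_of_hasWeakDeriv_zero hΩ hc (hf.sub hPl) (by
    intro ψ hψ
    have h1 := h ψ hψ
    have h2 := hP ψ hψ
    rw [hψ.deriv.setIntegral_mul_indicator, hψ.setIntegral_mul_indicator] at h1
    rw [hψ.deriv.setIntegral_mul, hψ.setIntegral_mul] at h2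
    rw [hψ.deriv.setIntegral_mul]
    simp only [Pi.sub_apply, sub_mul]
    rw [integral_sub (hψ.deriv.integrable_mul hf) (hψ.deriv.integrable_mul hPl), h1, h2]
    simp)
  refine ⟨c, ?_⟩
  filter_upwards [hcc, ae_restrict_mem hΩ.measurableSet] with x hx hxΩ
  simp only [Pi.sub_apply, indicator_of_mem hxΩ, hPdef, zero_add] at hx
  linarith
-- Pairing with test functions in L²
theorem locallyIntegrable_indicator_L2 {Ω : Set ℝ} (hΩ : MeasurableSet Ω) (f : L2 Ω) :
    LocallyIntegrable (Ω.indicator f) :=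
  ((memLp_indicator_iff_restrict hΩ).2 (Lp.memLp f)).locallyIntegrable (by norm_num)

/-- A test function as an element of `L²(Ω)`. -/
noncomputable def IsTestFunction.toL2 {Ω : Set ℝ} {ψ : ℝ → ℝ} (h : IsTestFunction Ω ψ) : L2 Ω :=
  (h.memLp (volume.restrict Ω)).toLp ψ

/-- As a Hilbert space inner product, the pairing is continuous in `f` and commutes with Bochner
integrals in time. -/
theorem IsTestFunction.inner_toL2 {Ω : Set ℝ} {ψ : ℝ → ℝ} (h : IsTestFunction Ω ψ) (f : L2 Ω) :
    inner ℝ f h.toL2 = ∫ x in Ω, f x * ψ x := by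
  rw [L2.inner_def]
  refine integral_congr_ae ?_
  filter_upwards [(h.memLp (volume.restrict Ω)).coeFn_toLp] with x hx
  rw [IsTestFunction.toL2, hx]
  simp [mul_comm]

theorem L2.eq_of_forall_inner_testFunction {Ω : Set ℝ} (hΩ : IsOpen Ω) {f g : L2 Ω}
    (h : ∀ ψ (hψ : IsTestFunction Ω ψ), inner ℝ f hψ.toL2 = inner ℝ g hψ.toL2) : f = g := by
  rw [← sub_eq_zero]
  apply Lp.ext
  have h0 : (Ω.indicator (f - g : L2 Ω)) =ᵐ[volume.restrict Ω] 0 := by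
    refine ae_eq_zero_of_forall_testFunction hΩ
      ((locallyIntegrable_indicator_L2 hΩ.measurableSet _).locallyIntegrableOn Ω) fun ψ hψ => ?_
    rw [hψ.setIntegral_mul, ← hψ.setIntegral_mul_indicator, ← hψ.inner_toL2, inner_sub_left, h,
      sub_self]
  filter_upwards [h0, ae_restrict_mem hΩ.measurableSet, Lp.coeFn_zero ℝ 2 (volume.restrict Ω)]
    with x hx hxΩ hz
  rw [hz, ← hx, indicator_of_mem hxΩ]

theorem hasWeakDeriv_L2_iff {Ω : Set ℝ} {f g : L2 Ω} :
    HasWeakDeriv Ω f g ↔ ∀ ψ (hψ : IsTestFunction Ω ψ),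
      inner ℝ f hψ.deriv.toL2 = -inner ℝ g hψ.toL2 := by
  simp only [IsTestFunction.inner_toL2, HasWeakDeriv]

theorem HasWeakDeriv.L2_sub {Ω : Set ℝ} {f g f' g' : L2 Ω} (h : HasWeakDeriv Ω f g)
    (h' : HasWeakDeriv Ω f' g') : HasWeakDeriv Ω (f - f' : L2 Ω) (g - g' : L2 Ω) := by
  rw [hasWeakDeriv_L2_iff] at *
  intro ψ hψ
  rw [inner_sub_left, inner_sub_left, h ψ hψ, h' ψ hψ]
  ring

theorem IsL2LocH2.sub {Ω : Set ℝ} {T : EReal} {u ux uxx v vx vxx : ℝ → L2 Ω}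
    (h : IsL2LocH2 Ω T u ux uxx) (h' : IsL2LocH2 Ω T v vx vxx) :
    IsL2LocH2 Ω T (fun t => u t - v t) (fun t => ux t - vx t) (fun t => uxx t - vxx t) where
  memLp_u T' hT' := (h.memLp_u T' hT').sub (h'.memLp_u T' hT')
  memLp_ux T' hT' := (h.memLp_ux T' hT').sub (h'.memLp_ux T' hT')
  memLp_uxx T' hT' := (h.memLp_uxx T' hT').sub (h'.memLp_uxx T' hT')
  weakDeriv_u := by
    filter_upwards [h.weakDeriv_u, h'.weakDeriv_u] with t h1 h2 using h1.L2_sub h2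
  weakDeriv_ux := by
    filter_upwards [h.weakDeriv_ux, h'.weakDeriv_ux] with t h1 h2 using h1.L2_sub h2

/-! ### The equations integrated in time -/

theorem Icc_subset_timeIntervalZero {T : EReal} {t : ℝ} (ht : t ∈ timeIntervalZero T) :
    Icc 0 t ⊆ timeIntervalZero T := fun _ hs =>
  ⟨hs.1, (EReal.coe_le_coe_iff.2 hs.2).trans_lt ht.2⟩

theorem Ioo_subset_timeInterval {T : EReal} {t : ℝ} (ht : t ∈ timeIntervalZero T) :
    Ioo 0 t ⊆ timeInterval T := fun _ hs =>
  ⟨hs.1, (EReal.coe_le_coe_iff.2 hs.2.le).trans_lt ht.2⟩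

theorem timeInterval_subset_timeIntervalZero (T : EReal) : timeInterval T ⊆ timeIntervalZero T :=
  fun _ ht => ⟨ht.1.le, ht.2⟩

theorem isOpen_timeInterval (T : EReal) : IsOpen (timeInterval T) :=
  isOpen_Ioi.inter (isOpen_Iio.preimage continuous_coe_real_ereal)

theorem intervalIntegrable_of_memLp_Ioo {E : Type*} [NormedAddCommGroup E] {f : ℝ → E} {t : ℝ}
    (ht : 0 ≤ t) (hf : MemLp f 2 (volume.restrict (Ioo 0 t))) :
    IntervalIntegrable f volume 0 t := by
  rw [intervalIntegrable_iff_integrableOn_Ioo_of_le ht]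
  exact hf.integrable (by norm_num)

theorem intervalIntegral_inner_left {E : Type*} [NormedAddCommGroup E] [InnerProductSpace ℝ E]
    [CompleteSpace E] {f : ℝ → E} {a b : ℝ} (hf : IntervalIntegrable f volume a b) (v : E) :
    inner ℝ (∫ s in a..b, f s) v = ∫ s in a..b, inner ℝ (f s) v := by
  simpa [real_inner_comm] using
    ((innerSL ℝ v).intervalIntegral_comp_comm hf).symm

/-- A continuous function of time whose distributional derivative is continuous up to `t = 0` is
the primitive of this derivative. -/
theorem eq_add_integral_of_hasWeakDeriv {T : EReal} {φ k : ℝ → ℝ}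
    (hφ : ContinuousOn φ (timeIntervalZero T)) (hk : ContinuousOn k (timeIntervalZero T))
    (h : HasWeakDeriv (timeInterval T) φ k) {t : ℝ} (ht : t ∈ timeIntervalZero T) :
    φ t = φ 0 + ∫ s in (0 : ℝ)..t, k s := by
  rcases ht.1.eq_or_lt with rfl | h0
  · simp
  -- Nothing is known outside `[0, T)`, so the functions are cut off to `(0, t)`.
  have hloc : ∀ f : ℝ → ℝ, ContinuousOn f (timeIntervalZero T) →
      LocallyIntegrable ((Ioo 0 t).indicator f) := fun f hf =>
    ((integrable_indicator_iff measurableSet_Ioo).2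
      (((hf.mono (Icc_subset_timeIntervalZero ht)).integrableOn_Icc).mono_set
        Ioo_subset_Icc_self)).locallyIntegrable
  obtain ⟨c, hc⟩ := (h.mono (Ioo_subset_timeInterval ht)).exists_ae_eq_primitive isOpen_Ioo
    ordConnected_Ioo (hloc φ hφ) (hloc k hk)
  have hP := continuous_primitive_const_add (hloc k hk) c
  rw [restrict_Ioo_eq_restrict_Icc] at hc
  have heq := Measure.eqOn_Icc_of_ae_eq volume h0.ne hc
    (hφ.mono (Icc_subset_timeIntervalZero ht)) hP.continuousOn
  have e0 := heq (left_mem_Icc.2 h0.le)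
  have e1 := heq (right_mem_Icc.2 h0.le)
  simp only [intervalIntegral.integral_same, add_zero] at e0
  rw [e1, e0]
  simp only [intervalIntegral.integral_of_le h0.le, integral_Ioc_eq_integral_Ioo]
  rw [setIntegral_congr_fun (g := k) measurableSet_Ioo fun s hs => indicator_of_mem hs _]

theorem continuousOn_inner_toL2 {Ω : Set ℝ} {ψ : ℝ → ℝ} (hψ : IsTestFunction Ω ψ)
    {f : ℝ → L2 Ω} {s : Set ℝ} (hf : ContinuousOn f s) :
    ContinuousOn (fun t => inner ℝ (f t) hψ.toL2) s :=
  hf.inner continuousOn_const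

theorem intervalIntegrable_of_continuousOn_timeIntervalZero {E : Type*} [NormedAddCommGroup E]
    {T : EReal} {f : ℝ → E} (hf : ContinuousOn f (timeIntervalZero T)) {t : ℝ}
    (ht : t ∈ timeIntervalZero T) : IntervalIntegrable f volume 0 t := by
  refine ContinuousOn.intervalIntegrable ?_
  rw [uIcc_of_le ht.1]
  exact hf.mono (Icc_subset_timeIntervalZero ht)

/-- The first equation, integrated in time. -/
theorem elevation_eq_sub_integral {Ω : Set ℝ} (hΩ : IsOpen Ω) {T : EReal}
    {η u ux uxx : ℝ → L2 Ω} (hη : ContinuousOn η (timeIntervalZero T))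
    (hu : ContinuousOn u (timeIntervalZero T)) (hH : IsL2LocH2 Ω T u ux uxx)
    (h : ∀ θ ψ : ℝ → ℝ, IsTestFunction (timeInterval T) θ → IsTestFunction Ω ψ →
      (∫ t in timeInterval T, deriv θ t * ∫ x in Ω, η t x * ψ x)
        + (∫ t in timeInterval T, θ t * ∫ x in Ω, u t x * deriv ψ x) = 0)
    {t : ℝ} (ht : t ∈ timeIntervalZero T) : η t = η 0 - ∫ s in (0 : ℝ)..t, ux s := by
  refine L2.eq_of_forall_inner_testFunction hΩ fun ψ hψ => ?_
  have hux := intervalIntegrable_of_memLp_Ioo ht.1 (hH.memLp_ux t ht.2)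
  have hw : HasWeakDeriv (timeInterval T) (fun s => inner ℝ (η s) hψ.toL2)
      (fun s => inner ℝ (u s) hψ.deriv.toL2) := fun θ hθ => by
    have := h θ ψ hθ hψ
    simp only [← hψ.inner_toL2, ← hψ.deriv.inner_toL2] at this
    simp only [mul_comm _ (deriv θ _), mul_comm _ (θ _)]
    linarith
  have h1 := eq_add_integral_of_hasWeakDeriv (continuousOn_inner_toL2 hψ hη)
    (continuousOn_inner_toL2 hψ.deriv hu) hw ht
  rw [h1, inner_sub_left, intervalIntegral_inner_left hux, sub_eq_add_neg,
    ← intervalIntegral.integral_neg]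
  congr 1
  rw [intervalIntegral.integral_of_le ht.1, intervalIntegral.integral_of_le ht.1,
    integral_Ioc_eq_integral_Ioo, integral_Ioc_eq_integral_Ioo]
  refine integral_congr_ae ?_
  filter_upwards [ae_restrict_of_ae_restrict_of_subset (Ioo_subset_timeInterval ht)
    hH.weakDeriv_u] with s hs
  exact hasWeakDeriv_L2_iff.1 hs ψ hψ

/-- The inner product of `u` with a second derivative of a test function. -/
theorem inner_deriv_deriv_toL2 {Ω : Set ℝ} {u ux uxx : L2 Ω} (h1 : HasWeakDeriv Ω u ux)
    (h2 : HasWeakDeriv Ω ux uxx) {ψ : ℝ → ℝ} (hψ : IsTestFunction Ω ψ) :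
    inner ℝ u hψ.deriv.deriv.toL2 = inner ℝ uxx hψ.toL2 := by
  rw [hasWeakDeriv_L2_iff.1 h1 _ hψ.deriv, hasWeakDeriv_L2_iff.1 h2 _ hψ, neg_neg]

/-- The second equation with constant coefficient, integrated in time and tested in space. -/
theorem velocity_tested_eq {Ω : Set ℝ} {T : EReal} {c : ℝ}
    {η u ux uxx : ℝ → L2 Ω} (hη : ContinuousOn η (timeIntervalZero T))
    (hu : ContinuousOn u (timeIntervalZero T)) (hH : IsL2LocH2 Ω T u ux uxx)
    (h : ∀ θ ψ : ℝ → ℝ, IsTestFunction (timeInterval T) θ → IsTestFunction Ω ψ →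
      (∫ t in timeInterval T, deriv θ t * ∫ x in Ω, (u t x - c * uxx t x) * ψ x)
        + (∫ t in timeInterval T, θ t * ∫ x in Ω, η t x * deriv ψ x) = 0)
    {ψ : ℝ → ℝ} (hψ : IsTestFunction Ω ψ) {t : ℝ} (ht : t ∈ timeIntervalZero T) :
    inner ℝ (u t) hψ.toL2 - c * inner ℝ (u t) hψ.deriv.deriv.toL2 =
      inner ℝ (u 0) hψ.toL2 - c * inner ℝ (u 0) hψ.deriv.deriv.toL2
        + ∫ s in (0 : ℝ)..t, inner ℝ (η s) hψ.deriv.toL2 := by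
  refine eq_add_integral_of_hasWeakDeriv (φ := fun t => inner ℝ (u t) hψ.toL2
    - c * inner ℝ (u t) hψ.deriv.deriv.toL2) ((continuousOn_inner_toL2 hψ hu).sub
    (continuousOn_const.mul (continuousOn_inner_toL2 hψ.deriv.deriv hu)))
    (continuousOn_inner_toL2 hψ.deriv hη)
    (fun θ hθ => ?_) ht
  have h1 := h θ ψ hθ hψ
  simp only [← hψ.deriv.inner_toL2] at h1
  -- Both space derivatives move to `ψ`: unlike `uxx`, `u` is continuous in time, as
  -- `eq_add_integral_of_hasWeakDeriv` requires.
  have h2 : ∫ t in timeInterval T, deriv θ t * ∫ x in Ω, (u t x - c * uxx t x) * ψ x =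
      ∫ t in timeInterval T, (inner ℝ (u t) hψ.toL2
        - c * inner ℝ (u t) hψ.deriv.deriv.toL2) * deriv θ t := by
    refine integral_congr_ae ?_
    filter_upwards [hH.weakDeriv_u, hH.weakDeriv_ux] with s hs1 hs2
    rw [inner_deriv_deriv_toL2 hs1 hs2 hψ, mul_comm]
    congr 1
    rw [← real_inner_smul_left, ← inner_sub_left, hψ.inner_toL2]
    refine integral_congr_ae ?_
    filter_upwards [Lp.coeFn_sub (u s) (c • uxx s), Lp.coeFn_smul c (uxx s)] with x h3 h4
    rw [h3, Pi.sub_apply, h4, Pi.smul_apply, smul_eq_mul]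
  rw [h2] at h1
  simp only [mul_comm (inner ℝ (η _) _) (θ _)]
  linarith
theorem continuousOn_integral_of_memLp {E : Type*} [NormedAddCommGroup E] [NormedSpace ℝ E]
    {T : EReal} {f : ℝ → E}
    (hf : ∀ T' : ℝ, (T' : EReal) < T → MemLp f 2 (volume.restrict (Ioo 0 T')))
    {t : ℝ} (ht : t ∈ timeIntervalZero T) :
    ContinuousOn (fun s => ∫ r in (0 : ℝ)..s, f r) (Icc 0 t) := by
  have h := intervalIntegrable_of_memLp_Ioo ht.1 (hf t ht.2)
  rw [← uIcc_of_le ht.1]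
  refine intervalIntegral.continuousOn_primitive_interval ?_
  rw [uIcc_of_le ht.1]
  exact (intervalIntegrable_iff_integrableOn_Icc_of_le ht.1).1 h

/-- The second equation for vanishing initial data, integrated in time. -/
theorem velocity_eq_of_tested {Ω : Set ℝ} (hΩ : IsOpen Ω) {T : EReal} {c : ℝ}
    {e w wx wxx : ℝ → L2 Ω} (hH : IsL2LocH2 Ω T w wx wxx)
    (he : ∀ t ∈ timeIntervalZero T, e t = -∫ s in (0 : ℝ)..t, wx s)
    (hw : ∀ ψ (hψ : IsTestFunction Ω ψ), ∀ t ∈ timeIntervalZero T,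
      inner ℝ (w t) hψ.toL2 - c * inner ℝ (w t) hψ.deriv.deriv.toL2 =
        ∫ s in (0 : ℝ)..t, inner ℝ (e s) hψ.deriv.toL2) :
    ∀ᵐ t ∂(volume.restrict (timeInterval T)),
      w t = c • wxx t + ∫ s in (0 : ℝ)..t, ∫ r in (0 : ℝ)..s, wxx r := by
  -- The weak derivative of `wx` is taken inside the time integral, turning `-∫ wx` tested with `ψ'`
  -- into `∫ wxx` tested with `ψ`.
  have key : ∀ ψ (hψ : IsTestFunction Ω ψ), ∀ s ∈ timeIntervalZero T,
      inner ℝ (e s) hψ.deriv.toL2 = inner ℝ (∫ r in (0 : ℝ)..s, wxx r) hψ.toL2 := by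
    intro ψ hψ s hs
    rw [he s hs, inner_neg_left,
      intervalIntegral_inner_left (intervalIntegrable_of_memLp_Ioo hs.1 (hH.memLp_ux s hs.2)),
      intervalIntegral_inner_left (intervalIntegrable_of_memLp_Ioo hs.1 (hH.memLp_uxx s hs.2)),
      ← intervalIntegral.integral_neg]
    rw [intervalIntegral.integral_of_le hs.1, intervalIntegral.integral_of_le hs.1,
      integral_Ioc_eq_integral_Ioo, integral_Ioc_eq_integral_Ioo]
    refine integral_congr_ae ?_
    filter_upwards [ae_restrict_of_ae_restrict_of_subset (Ioo_subset_timeInterval hs)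
      hH.weakDeriv_ux] with r hr
    rw [hasWeakDeriv_L2_iff.1 hr ψ hψ, neg_neg]
  filter_upwards [hH.weakDeriv_u, hH.weakDeriv_ux,
    ae_restrict_mem (isOpen_timeInterval T).measurableSet] with t h1 h2 ht
  have ht' := timeInterval_subset_timeIntervalZero T ht
  refine L2.eq_of_forall_inner_testFunction hΩ fun ψ hψ => ?_
  have h3 := hw ψ hψ t ht'
  have hint : IntervalIntegrable (fun s => ∫ r in (0 : ℝ)..s, wxx r) volume 0 t :=
    ContinuousOn.intervalIntegrable (by
      rw [uIcc_of_le ht'.1]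
      exact continuousOn_integral_of_memLp hH.memLp_uxx ht')
  rw [inner_deriv_deriv_toL2 h1 h2 hψ, intervalIntegral.integral_congr
    (g := fun s => inner ℝ (∫ r in (0 : ℝ)..s, wxx r) hψ.toL2),
    ← intervalIntegral_inner_left hint] at h3
  · rw [inner_add_left, real_inner_smul_left]
    linarith
  · intro s hs
    rw [uIcc_of_le ht'.1] at hs
    exact key ψ hψ s (Icc_subset_timeIntervalZero ht' hs)

/-- The problem with constant coefficient `c` and vanishing initial data, integrated in time. -/
structure IsNullSolution (Ω : Set ℝ) (c : ℝ) (T : EReal) (e w wx wxx : ℝ → L2 Ω) : Prop where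
  isL2LocH2 : IsL2LocH2 Ω T w wx wxx
  continuousOn : ContinuousOn w (timeIntervalZero T)
  elevation_eq : ∀ t ∈ timeIntervalZero T, e t = -∫ s in (0 : ℝ)..t, wx s
  velocity_eq : ∀ᵐ t ∂(volume.restrict (timeInterval T)),
    w t = c • wxx t + ∫ s in (0 : ℝ)..t, ∫ r in (0 : ℝ)..s, wxx r

/-- The difference of two solutions with the same data. -/
theorem IsHomogeneousSolution.sub {Ω : Set ℝ} (hΩ : IsOpen Ω) {μ : ℝ} {T : EReal}
    {η₀ u₀ : ℝ → ℝ} {η u η' u' : ℝ → L2 Ω} (h : IsHomogeneousSolution Ω μ T η₀ u₀ η u)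
    (h' : IsHomogeneousSolution Ω μ T η₀ u₀ η' u') :
    ∃ wx wxx, IsNullSolution Ω (μ ^ 2) T (fun t => η t - η' t) (fun t => u t - u' t) wx wxx := by
  obtain ⟨hη, hu, hη0, hu0, ux, uxx, hH, heq⟩ := h
  obtain ⟨hη', hu', hη0', hu0', ux', uxx', hH', heq'⟩ := h'
  have hη00 : η 0 = η' 0 := Lp.ext (hη0.trans hη0'.symm)
  have hu00 : u 0 = u' 0 := Lp.ext (hu0.trans hu0'.symm)
  have he : ∀ t ∈ timeIntervalZero T, η t - η' t = -∫ s in (0 : ℝ)..t, (ux s - ux' s) := by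
    intro t ht
    rw [elevation_eq_sub_integral hΩ hη hu hH (fun θ ψ h1 h2 => (heq θ ψ h1 h2).1) ht,
      elevation_eq_sub_integral hΩ hη' hu' hH' (fun θ ψ h1 h2 => (heq' θ ψ h1 h2).1) ht,
      intervalIntegral.integral_sub (intervalIntegrable_of_memLp_Ioo ht.1 (hH.memLp_ux t ht.2))
      (intervalIntegrable_of_memLp_Ioo ht.1 (hH'.memLp_ux t ht.2)), hη00]
    abel
  refine ⟨fun t => ux t - ux' t, fun t => uxx t - uxx' t, hH.sub hH', hu.sub hu', he,
    velocity_eq_of_tested hΩ (hH.sub hH') he fun ψ hψ t ht => ?_⟩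
  have h1 := velocity_tested_eq hη hu hH (fun θ ψ h1 h2 => (heq θ ψ h1 h2).2) hψ ht
  have h2 := velocity_tested_eq hη' hu' hH' (fun θ ψ h1 h2 => (heq' θ ψ h1 h2).2) hψ ht
  rw [hu00] at h1
  simp only [inner_sub_left]
  rw [intervalIntegral.integral_sub
    (intervalIntegrable_of_continuousOn_timeIntervalZero (continuousOn_inner_toL2 hψ.deriv hη) ht)
    (intervalIntegrable_of_continuousOn_timeIntervalZero (continuousOn_inner_toL2 hψ.deriv hη')
      ht)]
  linarith

/-! ### Restriction of solutions to a subset -/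

/-- Restriction from `L²(Ω')` to `L²(Ω)` for `Ω ⊆ Ω'`. -/
noncomputable def restrictL2 {Ω Ω' : Set ℝ} (h : Ω ⊆ Ω') : L2 Ω' →L[ℝ] L2 Ω :=
  LinearMap.mkContinuous
    { toFun := fun f => ((Lp.memLp f).mono_measure (Measure.restrict_mono h le_rfl)).toLp f
      map_add' := fun f g => by
        rw [← MemLp.toLp_add]
        exact MemLp.toLp_congr _ _ (ae_restrict_of_ae_restrict_of_subset h (Lp.coeFn_add f g))
      map_smul' := fun c f => by
        rw [RingHom.id_apply, ← MemLp.toLp_const_smul]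
        exact MemLp.toLp_congr _ _ (ae_restrict_of_ae_restrict_of_subset h (Lp.coeFn_smul c f)) }
    1 fun f => by
      rw [one_mul, LinearMap.coe_mk, AddHom.coe_mk, Lp.norm_toLp, Lp.norm_def]
      exact ENNReal.toReal_mono (Lp.eLpNorm_ne_top f)
        (eLpNorm_mono_measure f (Measure.restrict_mono h le_rfl))

theorem restrictL2_ae_eq {Ω Ω' : Set ℝ} (h : Ω ⊆ Ω') (f : L2 Ω') :
    restrictL2 h f =ᵐ[volume.restrict Ω] f :=
  MemLp.coeFn_toLp ((Lp.memLp f).mono_measure (Measure.restrict_mono h le_rfl))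

theorem setIntegral_restrictL2_mul {Ω Ω' : Set ℝ} (h : Ω ⊆ Ω') (f : L2 Ω') {ψ : ℝ → ℝ}
    (hψ : IsTestFunction Ω ψ) :
    ∫ x in Ω, restrictL2 h f x * ψ x = ∫ x in Ω', f x * ψ x := by
  rw [hψ.setIntegral_mul_of_subset h]
  refine integral_congr_ae ?_
  filter_upwards [restrictL2_ae_eq h f] with x hx
  rw [hx]

theorem HasWeakDeriv.restrictL2 {Ω Ω' : Set ℝ} (h : Ω ⊆ Ω') {f g : L2 Ω'}
    (hfg : HasWeakDeriv Ω' f g) : HasWeakDeriv Ω (restrictL2 h f) (restrictL2 h g) :=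
  (hfg.mono h).congr (restrictL2_ae_eq h f).symm (restrictL2_ae_eq h g).symm

theorem IsL2LocH2.restrictL2 {Ω Ω' : Set ℝ} (h : Ω ⊆ Ω') {T : EReal} {u ux uxx : ℝ → L2 Ω'}
    (hH : IsL2LocH2 Ω' T u ux uxx) :
    IsL2LocH2 Ω T (fun t => restrictL2 h (u t)) (fun t => restrictL2 h (ux t))
      (fun t => restrictL2 h (uxx t)) where
  memLp_u T' hT' := (_root_.restrictL2 h).comp_memLp' (hH.memLp_u T' hT')
  memLp_ux T' hT' := (_root_.restrictL2 h).comp_memLp' (hH.memLp_ux T' hT')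
  memLp_uxx T' hT' := (_root_.restrictL2 h).comp_memLp' (hH.memLp_uxx T' hT')
  weakDeriv_u := by filter_upwards [hH.weakDeriv_u] with t ht using ht.restrictL2 h
  weakDeriv_ux := by filter_upwards [hH.weakDeriv_ux] with t ht using ht.restrictL2 h

/-- The restriction of a solution is a solution. -/
theorem IsSolution.restrictL2 {Ω Ω' : Set ℝ} (hΩ : MeasurableSet Ω) (h : Ω ⊆ Ω')
    {m m' : ℝ → ℝ} (hm : ∀ x ∈ Ω, m' x = m x) {T : EReal} {η₀ u₀ : ℝ → ℝ} {η u : ℝ → L2 Ω'}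
    (hW : IsSolution Ω' m' T η₀ u₀ η u) :
    IsSolution Ω m T η₀ u₀ (fun t => restrictL2 h (η t)) (fun t => restrictL2 h (u t)) := by
  obtain ⟨hη, hu, hη0, hu0, ux, uxx, hH, heq⟩ := hW
  refine ⟨(_root_.restrictL2 h).continuous.comp_continuousOn hη,
    (_root_.restrictL2 h).continuous.comp_continuousOn hu,
    (restrictL2_ae_eq h _).trans (ae_restrict_of_ae_restrict_of_subset h hη0),
    (restrictL2_ae_eq h _).trans (ae_restrict_of_ae_restrict_of_subset h hu0), _, _,
    hH.restrictL2 h,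
    fun θ ψ hθ hψ => ?_⟩
  have h1 := heq θ ψ hθ (hψ.mono h)
  have h2 : ∀ t,
      ∫ x in Ω, (_root_.restrictL2 h (u t) x - m x * _root_.restrictL2 h (uxx t) x) * ψ x
      = ∫ x in Ω', (u t x - m' x * uxx t x) * ψ x := by
    intro t
    rw [hψ.setIntegral_mul_of_subset h]
    refine integral_congr_ae ?_
    filter_upwards [restrictL2_ae_eq h (u t), restrictL2_ae_eq h (uxx t), ae_restrict_mem hΩ]
      with x hx hx' hxΩ
    rw [hx, hx', hm x hxΩ]
  simp only [h2, setIntegral_restrictL2_mul h _ hψ, setIntegral_restrictL2_mul h _ hψ.deriv]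
  exact h1
-- Traces at the interface
theorem eq_at_of_ae_eq_restrict {Ω : Set ℝ} (hΩ : IsOpen Ω) {x : ℝ} (hx : x ∈ closure Ω)
    {f g : ℝ → ℝ} (hf : Continuous f) (hg : Continuous g) (h : f =ᵐ[volume.restrict Ω] g) :
    EqOn f g Ω ∧ f x = g x := by
  have h1 : EqOn f g Ω := Measure.eqOn_open_of_ae_eq h hΩ hf.continuousOn hg.continuousOn
  exact ⟨h1, h1.closure hf hg hx⟩

theorem hasWeakDeriv_of_contDiff {F : ℝ → ℝ} (hF : ContDiff ℝ 1 F) (Ω : Set ℝ) :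
    HasWeakDeriv Ω F (deriv F) := by
  have hc : Continuous (deriv F) := hF.continuous_deriv le_rfl
  have h := (hasWeakDeriv_primitive hc.locallyIntegrable (F 0)).mono (subset_univ Ω)
  convert h using 1
  ext x
  rw [intervalIntegral.integral_deriv_eq_sub
    (fun y _ => (hF.differentiable one_ne_zero).differentiableAt)
    (hc.intervalIntegrable _ _)]
  ring

theorem ae_eq_of_hasWeakDeriv {Ω : Set ℝ} (hΩ : IsOpen Ω) {f g g' : ℝ → ℝ}
    (hg : LocallyIntegrable (Ω.indicator g)) (hg' : LocallyIntegrable (Ω.indicator g'))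
    (h : HasWeakDeriv Ω f g) (h' : HasWeakDeriv Ω f g') : g =ᵐ[volume.restrict Ω] g' := by
  have h0 := ae_eq_zero_of_forall_testFunction hΩ ((hg.sub hg').locallyIntegrableOn Ω)
    fun ψ hψ => by
      rw [hψ.setIntegral_mul]
      simp only [Pi.sub_apply, sub_mul]
      rw [integral_sub (hψ.integrable_mul hg) (hψ.integrable_mul hg'),
        ← hψ.setIntegral_mul_indicator, ← hψ.setIntegral_mul_indicator]
      linarith [h ψ hψ, h' ψ hψ]
  filter_upwards [h0, ae_restrict_mem hΩ.measurableSet] with x hx hxΩ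
  simpa [hxΩ, sub_eq_zero] using hx

namespace HasInterfaceTraces

variable {Ω Ω' : Set ℝ} {f f' : ℝ → ℝ} {a b a' b' : ℝ}

theorem mono (h : HasInterfaceTraces Ω' f a b) (hΩ : Ω ⊆ Ω') : HasInterfaceTraces Ω f a b := by
  obtain ⟨F, h1, h2, h3⟩ := h
  exact ⟨F, h1, ae_restrict_of_ae_restrict_of_subset hΩ h2, h3⟩

theorem congr (h : HasInterfaceTraces Ω f a b) (hf : f =ᵐ[volume.restrict Ω] f') :
    HasInterfaceTraces Ω f' a b := by
  obtain ⟨F, h1, h2, h3⟩ := h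
  exact ⟨F, h1, hf.symm.trans h2, h3⟩

theorem sub (h : HasInterfaceTraces Ω f a b) (h' : HasInterfaceTraces Ω f' a' b') :
    HasInterfaceTraces Ω (f - f') (a - a') (b - b') := by
  obtain ⟨F, h1, h2, rfl, rfl⟩ := h
  obtain ⟨F', h1', h2', rfl, rfl⟩ := h'
  refine ⟨F - F', h1.sub h1', h2.sub h2', rfl, ?_⟩
  exact deriv_sub (h1.differentiable one_ne_zero).differentiableAt
    (h1'.differentiable one_ne_zero).differentiableAt

theorem unique (hΩ : IsOpen Ω) (h0 : (0 : ℝ) ∈ closure Ω) (h : HasInterfaceTraces Ω f a b)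
    (h' : HasInterfaceTraces Ω f a' b') : a = a' ∧ b = b' := by
  obtain ⟨F, h1, h2, rfl, rfl⟩ := h
  obtain ⟨F', h1', h2', rfl, rfl⟩ := h'
  obtain ⟨he, he0⟩ := eq_at_of_ae_eq_restrict hΩ h0 h1.continuous h1'.continuous
    (h2.symm.trans h2')
  have hd : EqOn (deriv F) (deriv F') Ω := fun x hx =>
    (he.eventuallyEq_of_mem (hΩ.mem_nhds hx)).deriv_eq
  exact ⟨he0, hd.closure (h1.continuous_deriv le_rfl) (h1'.continuous_deriv le_rfl) h0⟩

/-- The function and its derivative are the primitives that start from the traces. -/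
theorem ae_eq_primitive (hΩ : IsOpen Ω) (hc : Ω.OrdConnected) (h0 : (0 : ℝ) ∈ closure Ω)
    {f fx fxx : L2 Ω} (h : HasInterfaceTraces Ω f a b) (hfx : HasWeakDeriv Ω f fx)
    (hfxx : HasWeakDeriv Ω fx fxx) :
    (f =ᵐ[volume.restrict Ω] fun x => a + ∫ t in (0 : ℝ)..x, Ω.indicator fx t) ∧
      (fx =ᵐ[volume.restrict Ω] fun x => b + ∫ t in (0 : ℝ)..x, Ω.indicator fxx t) := by
  obtain ⟨F, h1, h2, rfl, rfl⟩ := h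
  have hl := locallyIntegrable_indicator_L2 hΩ.measurableSet
  have hF' : Continuous (deriv F) := h1.continuous_deriv le_rfl
  have hderiv : fx =ᵐ[volume.restrict Ω] deriv F :=
    ae_eq_of_hasWeakDeriv hΩ (hl fx)
      (hF'.locallyIntegrable.indicator hΩ.measurableSet)
      (hfx.congr h2 Filter.EventuallyEq.rfl) (hasWeakDeriv_of_contDiff h1 Ω)
  obtain ⟨c, hcf⟩ := hfx.exists_ae_eq_primitive hΩ hc (hl f) (hl fx)
  obtain ⟨d, hdf⟩ := hfxx.exists_ae_eq_primitive hΩ hc (hl fx) (hl fxx)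
  -- Two continuous functions equal almost everywhere on `Ω` agree at 0, a point of its closure;
  -- this identifies the constants with the traces.
  have e1 := (eq_at_of_ae_eq_restrict hΩ h0 h1.continuous
    (continuous_primitive_const_add (hl fx) c) (h2.symm.trans hcf)).2
  have e2 := (eq_at_of_ae_eq_restrict hΩ h0 hF'
    (continuous_primitive_const_add (hl fxx) d) (hderiv.symm.trans hdf)).2
  simp only [intervalIntegral.integral_same, add_zero] at e1 e2
  rw [e1, e2]
  exact ⟨hcf, hdf⟩

end HasInterfaceTraces

/-- A function in `H²(ℝ)` is continuously differentiable. -/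
theorem exists_hasInterfaceTraces_of_hasWeakDeriv {f fx fxx : L2 (univ : Set ℝ)}
    (hfx : HasWeakDeriv univ f fx) (hfxx : HasWeakDeriv univ fx fxx) :
    ∃ a b, HasInterfaceTraces univ f a b := by
  have hl := locallyIntegrable_indicator_L2 MeasurableSet.univ
  obtain ⟨c, hcf⟩ := hfx.exists_ae_eq_primitive isOpen_univ ordConnected_univ (hl f) (hl fx)
  obtain ⟨d, hdf⟩ := hfxx.exists_ae_eq_primitive isOpen_univ ordConnected_univ (hl fx) (hl fxx)
  have hV := continuous_primitive_const_add (hl fxx) d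
  set V := fun x => d + ∫ t in (0 : ℝ)..x, univ.indicator fxx t
  have hU : ∀ x, HasDerivAt (fun x => c + ∫ t in (0 : ℝ)..x, V t) (V x) x := fun x =>
    (intervalIntegral.integral_hasDerivAt_right (hV.intervalIntegrable _ _)
      hV.aestronglyMeasurable.stronglyMeasurableAtFilter hV.continuousAt).const_add c
  refine ⟨_, _, fun x => c + ∫ t in (0 : ℝ)..x, V t, ?_, ?_, rfl, rfl⟩
  · rw [contDiff_one_iff_deriv]
    exact ⟨fun x => (hU x).differentiableAt, by
      rw [show deriv (fun x => c + ∫ t in (0 : ℝ)..x, V t) = V from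
        funext fun x => (hU x).deriv]
      exact hV⟩
  · filter_upwards [hcf] with x hx
    rw [hx]
    congr 1
    refine intervalIntegral.integral_congr_ae ?_
    filter_upwards [(ae_restrict_iff' MeasurableSet.univ).1 hdf] with t ht _
    rw [indicator_univ, ht (mem_univ t)]

/-! ### Integration by parts on the half-lines -/

theorem integrableOn_mul_of_L2 {Ω : Set ℝ} (f g : L2 Ω) : IntegrableOn (fun x => f x * g x) Ω :=
  (Lp.memLp f).integrable_mul (Lp.memLp g)

theorem inner_L2_eq_integral_mul {Ω : Set ℝ} (f g : L2 Ω) :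
    inner ℝ f g = ∫ x in Ω, f x * g x := by
  rw [L2.inner_def]
  simp [mul_comm]

section Boundary

variable {Ω : Set ℝ} {f fx g gx : L2 Ω} {P₀ Q₀ : ℝ}

/-- The integral of the derivative of a product of two `H¹` functions over an interval, and the
integrability of this product. -/
theorem product_of_primitives (hΩ : IsOpen Ω)
    (hf : f =ᵐ[volume.restrict Ω] fun x => P₀ + ∫ t in (0 : ℝ)..x, Ω.indicator fx t)
    (hg : g =ᵐ[volume.restrict Ω] fun x => Q₀ + ∫ t in (0 : ℝ)..x, Ω.indicator gx t) :
    ∃ k R : ℝ → ℝ, IntegrableOn k Ω ∧ IntegrableOn R Ω ∧ R 0 = P₀ * Q₀ ∧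
      (∀ a b, ∫ x in a..b, k x = R b - R a) ∧
      inner ℝ fx g + inner ℝ f gx = ∫ x in Ω, k x := by
  have hl := locallyIntegrable_indicator_L2 hΩ.measurableSet
  set P := fun x => P₀ + ∫ t in (0 : ℝ)..x, Ω.indicator fx t with hP
  set Q := fun x => Q₀ + ∫ t in (0 : ℝ)..x, Ω.indicator gx t with hQ
  have hk : (fun x => fx x * g x + f x * gx x) =ᵐ[volume.restrict Ω]
      fun x => Ω.indicator fx x * Q x + P x * Ω.indicator gx x := by
    filter_upwards [hf, hg, ae_restrict_mem hΩ.measurableSet] with x h1 h2 hx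
    rw [indicator_of_mem hx, indicator_of_mem hx, h1, h2]
  have hR : (fun x => f x * g x) =ᵐ[volume.restrict Ω] fun x => P x * Q x := by
    filter_upwards [hf, hg] with x h1 h2
    rw [h1, h2]
  refine ⟨_, fun x => P x * Q x, Integrable.congr ((integrableOn_mul_of_L2 fx g).add
    (integrableOn_mul_of_L2 f gx)) hk, (integrableOn_mul_of_L2 f g).congr hR, by simp [hP, hQ],
    fun a b => integral_primitive_mul_primitive (hl fx) (hl gx) P₀ Q₀ a b, ?_⟩
  rw [← integral_congr_ae hk, inner_L2_eq_integral_mul, inner_L2_eq_integral_mul]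
  exact (integral_add (integrableOn_mul_of_L2 fx g) (integrableOn_mul_of_L2 f gx)).symm

end Boundary

/-- The product `f g` has an integrable derivative, so it has a limit at infinity; being itself
integrable, its limit is 0. Only the boundary term at 0 survives. -/
theorem inner_add_inner_eq_of_primitives_Ioi {f fx g gx : L2 (Ioi 0)} {P₀ Q₀ : ℝ}
    (hf : f =ᵐ[volume.restrict (Ioi 0)] fun x => P₀ + ∫ t in (0 : ℝ)..x, (Ioi 0).indicator fx t)
    (hg : g =ᵐ[volume.restrict (Ioi 0)] fun x => Q₀ + ∫ t in (0 : ℝ)..x, (Ioi 0).indicator gx t) :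
    inner ℝ fx g + inner ℝ f gx = -(P₀ * Q₀) := by
  obtain ⟨k, R, hk, hR, h0, hkR, h⟩ := product_of_primitives isOpen_Ioi hf hg
  rw [h]
  have h1 := intervalIntegral_tendsto_integral_Ioi 0 hk Filter.tendsto_id
  simp only [hkR, id, h0] at h1
  have h2 : Filter.Tendsto R Filter.atTop (nhds ((∫ x in Ioi 0, k x) + P₀ * Q₀)) := by
    simpa using h1.add_const (P₀ * Q₀)
  have h3 := IntegrableAtFilter.eq_zero_of_tendsto (μ := volume)
    ⟨Ioi 0, Filter.Ioi_mem_atTop 0, hR⟩ (fun s hs => by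
      obtain ⟨a, ha⟩ := Filter.mem_atTop_sets.1 hs
      exact top_le_iff.1 (Real.volume_Ici (a := a) ▸ measure_mono fun x hx => ha x hx)) h2
  linarith

/-- Here 0 is the right endpoint, so the boundary term has the opposite sign; the cancellation
across the interface rests on this. -/
theorem inner_add_inner_eq_of_primitives_Iio {f fx g gx : L2 (Iio 0)} {P₀ Q₀ : ℝ}
    (hf : f =ᵐ[volume.restrict (Iio 0)] fun x => P₀ + ∫ t in (0 : ℝ)..x, (Iio 0).indicator fx t)
    (hg : g =ᵐ[volume.restrict (Iio 0)] fun x => Q₀ + ∫ t in (0 : ℝ)..x, (Iio 0).indicator gx t) :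
    inner ℝ fx g + inner ℝ f gx = P₀ * Q₀ := by
  obtain ⟨k, R, hk, hR, h0, hkR, h⟩ := product_of_primitives isOpen_Iio hf hg
  rw [h, ← integral_Iic_eq_integral_Iio]
  have h1 := intervalIntegral_tendsto_integral_Iic 0
    (integrableOn_Iic_iff_integrableOn_Iio (μ := volume) |>.2 hk) Filter.tendsto_id
  simp only [hkR, id, h0] at h1
  have h2 : Filter.Tendsto R Filter.atBot (nhds (P₀ * Q₀ - ∫ x in Iic 0, k x)) := by
    simpa using h1.const_sub (P₀ * Q₀)
  have h3 := IntegrableAtFilter.eq_zero_of_tendsto (μ := volume)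
    ⟨Iio 0, Filter.Iio_mem_atBot 0, hR⟩ (fun s hs => by
      obtain ⟨a, ha⟩ := Filter.mem_atBot_sets.1 hs
      exact top_le_iff.1 (Real.volume_Iic (a := a) ▸ measure_mono fun x hx => ha x hx)) h2
  linarith
-- Absolute continuity and differentiation of Hilbert-valued primitives
theorem AbsolutelyContinuousOnInterval.of_dist_le {X Y : Type*} [PseudoMetricSpace X]
    [PseudoMetricSpace Y] {f : ℝ → X} {g : ℝ → Y} {a b : ℝ}
    (hg : AbsolutelyContinuousOnInterval g a b)
    (h : ∀ x ∈ uIcc a b, ∀ y ∈ uIcc a b, dist (f x) (f y) ≤ dist (g x) (g y)) :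
    AbsolutelyContinuousOnInterval f a b := by
  rw [absolutelyContinuousOnInterval_iff] at hg ⊢
  intro ε hε
  obtain ⟨δ, hδ, H⟩ := hg ε hε
  exact ⟨δ, hδ, fun E hE hlt => (Finset.sum_le_sum fun i hi =>
    h _ (hE.1 i hi).1 _ (hE.1 i hi).2).trans_lt (H E hE hlt)⟩

section Primitive

variable {H : Type*} [NormedAddCommGroup H] [InnerProductSpace ℝ H]
  {f : ℝ → H} {t : ℝ}

/-- Increments of the norm of the primitive are bounded by those of the primitive of `‖f‖`, a real
absolutely continuous function. -/
theorem absolutelyContinuousOnInterval_norm_integral_sq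
    (hf : IntervalIntegrable f volume 0 t) :
    AbsolutelyContinuousOnInterval (fun s => ‖∫ r in (0 : ℝ)..s, f r‖ ^ 2) 0 t := by
  have h0 : AbsolutelyContinuousOnInterval (fun s => ‖∫ r in (0 : ℝ)..s, f r‖) 0 t := by
    refine (hf.norm.absolutelyContinuousOnInterval_intervalIntegral left_mem_uIcc).of_dist_le
      fun x hx y hy => ?_
    have hi : ∀ z ∈ uIcc 0 t, IntervalIntegrable f volume 0 z := fun z hz =>
      hf.mono_set (uIcc_subset_uIcc_left hz)
    rw [Real.dist_eq, Real.dist_eq, intervalIntegral.integral_interval_sub_left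
      (hi x hx).norm (hi y hy).norm]
    refine (abs_norm_sub_norm_le _ _).trans ?_
    rw [intervalIntegral.integral_interval_sub_left (hi x hx) (hi y hy)]
    exact intervalIntegral.norm_integral_le_abs_integral_norm
  simpa [sq] using h0.fun_mul h0

theorem ae_hasDerivAt_norm_integral_sq [CompleteSpace H] (hf : IntervalIntegrable f volume 0 t) :
    ∀ᵐ s, s ∈ uIcc 0 t → HasDerivAt (fun s => ‖∫ r in (0 : ℝ)..s, f r‖ ^ 2)
      (2 * inner ℝ (∫ r in (0 : ℝ)..s, f r) (f s)) s := by
  filter_upwards [hf.ae_hasDerivAt_integral] with s hs hmem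
  exact (hs hmem 0 left_mem_uIcc).norm_sq

/-- A function with vanishing primitive vanishes. -/
theorem ae_eq_zero_of_integral_eq_zero [CompleteSpace H] (ht : 0 ≤ t)
    (hf : IntervalIntegrable f volume 0 t) (h : ∀ s ∈ Icc 0 t, ∫ r in (0 : ℝ)..s, f r = 0) :
    ∀ᵐ s ∂(volume.restrict (Ioo 0 t)), f s = 0 := by
  rw [ae_restrict_iff' measurableSet_Ioo]
  filter_upwards [hf.ae_hasDerivAt_integral] with s hs hmem
  have h1 := hs (by rw [uIcc_of_le ht]; exact Ioo_subset_Icc_self hmem) 0 left_mem_uIcc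
  have h2 : (fun x => ∫ r in (0 : ℝ)..x, f r) =ᶠ[nhds s] fun _ => 0 := by
    filter_upwards [Ioo_mem_nhds hmem.1 hmem.2] with x hx using h x (Ioo_subset_Icc_self hx)
  exact (h1.congr_of_eventuallyEq h2.symm).unique (hasDerivAt_const s 0)

end Primitive

/-! ### The energy argument -/

namespace IsNullSolution

/-- The energy of the problem integrated in time. -/
noncomputable def energy {Ω : Set ℝ} (c : ℝ) (wx wxx : ℝ → L2 Ω) (s : ℝ) : ℝ :=
  ‖∫ r in (0 : ℝ)..s, wx r‖ ^ 2 + c * ‖∫ r in (0 : ℝ)..s, wxx r‖ ^ 2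
    + ‖∫ r in (0 : ℝ)..s, ∫ q in (0 : ℝ)..r, wxx q‖ ^ 2

variable {Ω : Set ℝ} {c : ℝ} {T : EReal} {e w wx wxx : ℝ → L2 Ω} {t : ℝ}

theorem intervalIntegrable_wx (h : IsNullSolution Ω c T e w wx wxx)
    (ht : t ∈ timeIntervalZero T) : IntervalIntegrable wx volume 0 t :=
  intervalIntegrable_of_memLp_Ioo ht.1 (h.isL2LocH2.memLp_ux t ht.2)

theorem intervalIntegrable_wxx (h : IsNullSolution Ω c T e w wx wxx)
    (ht : t ∈ timeIntervalZero T) : IntervalIntegrable wxx volume 0 t :=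
  intervalIntegrable_of_memLp_Ioo ht.1 (h.isL2LocH2.memLp_uxx t ht.2)

theorem intervalIntegrable_integral_wxx (h : IsNullSolution Ω c T e w wx wxx)
    (ht : t ∈ timeIntervalZero T) :
    IntervalIntegrable (fun s => ∫ r in (0 : ℝ)..s, wxx r) volume 0 t :=
  ContinuousOn.intervalIntegrable (by
    rw [uIcc_of_le ht.1]
    exact continuousOn_integral_of_memLp h.isL2LocH2.memLp_uxx ht)

theorem absolutelyContinuousOnInterval_energy (h : IsNullSolution Ω c T e w wx wxx)
    (ht : t ∈ timeIntervalZero T) : AbsolutelyContinuousOnInterval (energy c wx wxx) 0 t :=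
  ((absolutelyContinuousOnInterval_norm_integral_sq (h.intervalIntegrable_wx ht)).add
    ((absolutelyContinuousOnInterval_norm_integral_sq
      (h.intervalIntegrable_wxx ht)).const_mul c)).add
    (absolutelyContinuousOnInterval_norm_integral_sq (h.intervalIntegrable_integral_wxx ht))

theorem intervalIntegrable_flux (h : IsNullSolution Ω c T e w wx wxx)
    (ht : t ∈ timeIntervalZero T) (s : ℝ) :
    IntervalIntegrable (fun r => inner ℝ (wx r) (wx s) + inner ℝ (wxx r) (w s)) volume 0 t := by
  have hi : ∀ {f : ℝ → L2 Ω} (v : L2 Ω), IntervalIntegrable f volume 0 t →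
      IntervalIntegrable (fun r => inner ℝ (f r) v) volume 0 t := fun v hf =>
    ⟨hf.1.inner_const v, hf.2.inner_const v⟩
  exact (hi _ (h.intervalIntegrable_wx ht)).add (hi _ (h.intervalIntegrable_wxx ht))

/-- The energy balance. -/
theorem ae_hasDerivAt_energy (h : IsNullSolution Ω c T e w wx wxx)
    (ht : t ∈ timeIntervalZero T) :
    ∀ᵐ s, s ∈ uIcc 0 t → HasDerivAt (energy c wx wxx)
      (2 * ∫ r in (0 : ℝ)..s, (inner ℝ (wx r) (wx s) + inner ℝ (wxx r) (w s))) s := by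
  have hv := (ae_restrict_iff' (isOpen_timeInterval T).measurableSet).1 h.velocity_eq
  filter_upwards [hv, ae_hasDerivAt_norm_integral_sq (h.intervalIntegrable_wx ht),
    ae_hasDerivAt_norm_integral_sq (h.intervalIntegrable_wxx ht),
    ae_hasDerivAt_norm_integral_sq (h.intervalIntegrable_integral_wxx ht),
    Measure.ae_ne volume 0] with s hvs h1 h2 h3 hne hmem
  have hs := hmem
  rw [uIcc_of_le ht.1] at hs
  have hs0 := Icc_subset_timeIntervalZero ht hs
  have hvel := hvs ⟨hs.1.lt_of_ne' hne, hs0.2⟩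
  refine (((h1 hmem).add ((h2 hmem).const_mul c)).add (h3 hmem)).congr_deriv ?_
  have hi : ∀ {f : ℝ → L2 Ω} (v : L2 Ω), IntervalIntegrable f volume 0 s →
      IntervalIntegrable (fun r => inner ℝ (f r) v) volume 0 s := fun v hf =>
    ⟨hf.1.inner_const v, hf.2.inner_const v⟩
  -- The terms with `c` and with the double integral combine, by `hvel`, into the inner product of
  -- `∫ wxx` with `w s`.
  rw [intervalIntegral.integral_add (hi _ (h.intervalIntegrable_wx hs0))
    (hi _ (h.intervalIntegrable_wxx hs0)),
    ← intervalIntegral_inner_left (h.intervalIntegrable_wx hs0),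
    ← intervalIntegral_inner_left (h.intervalIntegrable_wxx hs0), hvel, inner_add_right,
    real_inner_smul_right, real_inner_comm (∫ r in (0 : ℝ)..s, wxx r) (∫ r in (0 : ℝ)..s, _)]
  ring

/-- A null solution without energy vanishes. -/
theorem eq_zero_of_energy_eq_zero (h : IsNullSolution Ω c T e w wx wxx) (hc : 0 ≤ c)
    (h0 : ∀ t ∈ timeIntervalZero T, energy c wx wxx t = 0) (ht : t ∈ timeIntervalZero T) :
    e t = 0 ∧ w t = 0 := by
  -- The factor `c` stays with `wxx`: for `c = 0` the second energy term says nothing, but only `c •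
  -- wxx` enters the velocity equation.
  have key : ∀ s ∈ timeIntervalZero T, ∫ r in (0 : ℝ)..s, wx r = 0 ∧
      ∫ r in (0 : ℝ)..s, c • wxx r = 0 ∧ ∫ r in (0 : ℝ)..s, ∫ q in (0 : ℝ)..r, wxx q = 0 := by
    intro s hs
    have h1 := h0 s hs
    have p1 := sq_nonneg ‖∫ r in (0 : ℝ)..s, wx r‖
    have p2 := mul_nonneg hc (sq_nonneg ‖∫ r in (0 : ℝ)..s, wxx r‖)
    have p3 := sq_nonneg ‖∫ r in (0 : ℝ)..s, ∫ q in (0 : ℝ)..r, wxx q‖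
    unfold energy at h1
    refine ⟨?_, ?_, ?_⟩
    · exact norm_eq_zero.1 (pow_eq_zero_iff two_ne_zero |>.1 (by linarith))
    · have : c * ‖∫ r in (0 : ℝ)..s, wxx r‖ ^ 2 = 0 := by linarith
      rw [intervalIntegral.integral_smul]
      rcases mul_eq_zero.1 this with hc0 | hn
      · rw [hc0, zero_smul]
      · rw [norm_eq_zero.1 (pow_eq_zero_iff two_ne_zero |>.1 hn), smul_zero]
    · exact norm_eq_zero.1 (pow_eq_zero_iff two_ne_zero |>.1 (by linarith))
  refine ⟨by rw [h.elevation_eq t ht, (key t ht).1, neg_zero], ?_⟩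
  -- A later time makes `[0, t']` nondegenerate even for `t = 0`, so that continuity upgrades almost
  -- everywhere to everywhere.
  obtain ⟨t', htt', ht'T⟩ := EReal.lt_iff_exists_real_btwn.1 ht.2
  have hlt : t < t' := EReal.coe_lt_coe_iff.1 htt'
  have hpos : 0 < t' := ht.1.trans_lt hlt
  have ht' : t' ∈ timeIntervalZero T := ⟨hpos.le, ht'T⟩
  have hz := ae_eq_zero_of_integral_eq_zero hpos.le ((h.intervalIntegrable_wxx ht').smul c)
    fun s hs => (key s (Icc_subset_timeIntervalZero ht' hs)).2.1
  have hw : w =ᵐ[volume.restrict (Icc 0 t')] fun _ => 0 := by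
    rw [← restrict_Ioo_eq_restrict_Icc]
    filter_upwards [hz, ae_restrict_of_ae_restrict_of_subset (Ioo_subset_timeInterval ht')
      h.velocity_eq, ae_restrict_mem measurableSet_Ioo] with s h1 h2 hs
    have h1' : c • wxx s = 0 := h1
    rw [h2, h1', (key s (Icc_subset_timeIntervalZero ht' (Ioo_subset_Icc_self hs))).2.2, add_zero]
  exact Measure.eqOn_Icc_of_ae_eq volume hpos.ne hw
    (h.continuousOn.mono (Icc_subset_timeIntervalZero ht')) continuousOn_const ⟨ht.1, hlt.le⟩

/-- Two null solutions on the half-lines whose interface traces agree vanish. -/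
theorem eq_zero_of_traces_eq {cm cp : ℝ} (hcm : 0 ≤ cm) (hcp : 0 ≤ cp) {T : EReal}
    {em wm wmx wmxx : ℝ → L2 (Iio 0)} {ep wp wpx wpxx : ℝ → L2 (Ioi 0)}
    (hm : IsNullSolution (Iio 0) cm T em wm wmx wmxx)
    (hp : IsNullSolution (Ioi 0) cp T ep wp wpx wpxx)
    (htr : ∀ᵐ t ∂(volume.restrict (timeInterval T)), ∃ a b,
      HasInterfaceTraces (Iio 0) (wm t) a b ∧ HasInterfaceTraces (Ioi 0) (wp t) a b)
    {t : ℝ} (ht : t ∈ timeIntervalZero T) : (em t = 0 ∧ wm t = 0) ∧ (ep t = 0 ∧ wp t = 0) := by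
  -- The good times: all four functions are primitives starting at 0 from common traces `a` and `b`.
  set G : ℝ → Prop := fun s => ∃ a b,
    (wm s =ᵐ[volume.restrict (Iio 0)]
      fun x => a + ∫ t in (0 : ℝ)..x, (Iio (0 : ℝ)).indicator (wmx s) t) ∧
    (wmx s =ᵐ[volume.restrict (Iio 0)]
      fun x => b + ∫ t in (0 : ℝ)..x, (Iio (0 : ℝ)).indicator (wmxx s) t) ∧
    (wp s =ᵐ[volume.restrict (Ioi 0)]
      fun x => a + ∫ t in (0 : ℝ)..x, (Ioi (0 : ℝ)).indicator (wpx s) t) ∧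
    (wpx s =ᵐ[volume.restrict (Ioi 0)]
      fun x => b + ∫ t in (0 : ℝ)..x, (Ioi (0 : ℝ)).indicator (wpxx s) t) with hG
  have hGae : ∀ᵐ s ∂(volume.restrict (timeInterval T)), G s := by
    filter_upwards [htr, hm.isL2LocH2.weakDeriv_u, hm.isL2LocH2.weakDeriv_ux,
      hp.isL2LocH2.weakDeriv_u, hp.isL2LocH2.weakDeriv_ux] with s hs h1 h2 h3 h4
    obtain ⟨a, b, ha, hb⟩ := hs
    obtain ⟨k1, k2⟩ := ha.ae_eq_primitive isOpen_Iio ordConnected_Iio (by simp) h1 h2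
    obtain ⟨k3, k4⟩ := hb.ae_eq_primitive isOpen_Ioi ordConnected_Ioi (by simp) h3 h4
    exact ⟨a, b, k1, k2, k3, k4⟩
  -- Two times are mixed: the trace of the derivative is taken at `r`, that of the function at `s`.
  have hflux : ∀ r s, G r → G s →
      (inner ℝ (wmx r) (wmx s) + inner ℝ (wmxx r) (wm s))
        + (inner ℝ (wpx r) (wpx s) + inner ℝ (wpxx r) (wp s)) = 0 := by
    rintro r s ⟨_, b, -, h2, -, h4⟩ ⟨a, _, h1, -, h3, -⟩
    have e1 := inner_add_inner_eq_of_primitives_Iio h2 h1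
    have e2 := inner_add_inner_eq_of_primitives_Ioi h4 h3
    linarith
  have hsum : ∀ s ∈ timeIntervalZero T, energy cm wmx wmxx s + energy cp wpx wpxx s = 0 := by
    intro s hs
    obtain ⟨C, hC⟩ := ((hm.absolutelyContinuousOnInterval_energy hs).add
      (hp.absolutelyContinuousOnInterval_energy hs)).const_of_ae_hasDerivAt_zero (by
        filter_upwards [hm.ae_hasDerivAt_energy hs, hp.ae_hasDerivAt_energy hs,
          (ae_restrict_iff' (isOpen_timeInterval T).measurableSet).1 hGae,
          Measure.ae_ne volume 0] with r h1 h2 hr hne hmem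
        have hr0 := hmem
        rw [uIcc_of_le hs.1] at hr0
        have hrT := Icc_subset_timeIntervalZero hs hr0
        refine ((h1 hmem).add (h2 hmem)).congr_deriv ?_
        rw [← mul_add, ← intervalIntegral.integral_add (hm.intervalIntegrable_flux hrT r)
          (hp.intervalIntegrable_flux hrT r), intervalIntegral.integral_of_le hrT.1,
          integral_Ioc_eq_integral_Ioo, integral_eq_zero_of_ae, mul_zero]
        filter_upwards [ae_restrict_of_ae_restrict_of_subset (Ioo_subset_timeInterval hrT) hGae]
          with q hq
        exact hflux q r hq (hr ⟨hr0.1.lt_of_ne' hne, hrT.2⟩))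
    -- The constant is the energy at time 0, where every integral is empty.
    have h0 := hC 0 left_mem_uIcc
    have hs' := hC s right_mem_uIcc
    simp only [Pi.add_apply] at h0 hs'
    rw [hs', ← h0]
    simp [energy]
  have hnn : ∀ {Ω : Set ℝ} {c : ℝ} (_ : 0 ≤ c) (wx wxx : ℝ → L2 Ω) (s : ℝ),
      0 ≤ energy c wx wxx s := fun hc wx wxx s => by
    unfold energy
    positivity
  exact ⟨hm.eq_zero_of_energy_eq_zero hcm (fun s hs => by
      linarith [hsum s hs, hnn hcm wmx wmxx s, hnn hcp wpx wpxx s]) ht,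
    hp.eq_zero_of_energy_eq_zero hcp (fun s hs => by
      linarith [hsum s hs, hnn hcm wmx wmxx s, hnn hcp wpx wpxx s]) ht⟩

end IsNullSolution
-- The hybrid solution and the theorem
theorem IsHybridSolution.restrict_Iio {μm μp : ℝ} {T : EReal} {η₀ u₀ : ℝ → ℝ}
    {η u : ℝ → L2 (univ : Set ℝ)} (h : IsHybridSolution μm μp T η₀ u₀ η u) :
    IsHomogeneousSolution (Iio 0) μm T η₀ u₀ (fun t => restrictL2 (subset_univ _) (η t))
      (fun t => restrictL2 (subset_univ _) (u t)) :=
  IsSolution.restrictL2 measurableSet_Iio (subset_univ _)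
    (fun _ hx => if_pos (mem_Iio.1 hx)) h

theorem IsHybridSolution.restrict_Ioi {μm μp : ℝ} {T : EReal} {η₀ u₀ : ℝ → ℝ}
    {η u : ℝ → L2 (univ : Set ℝ)} (h : IsHybridSolution μm μp T η₀ u₀ η u) :
    IsHomogeneousSolution (Ioi 0) μp T η₀ u₀ (fun t => restrictL2 (subset_univ _) (η t))
      (fun t => restrictL2 (subset_univ _) (u t)) :=
  IsSolution.restrictL2 measurableSet_Ioi (subset_univ _)
    (fun _ hx => if_neg (not_lt.2 (mem_Ioi.1 hx).le)) h

theorem IsHybridSolution.ae_exists_hasInterfaceTraces {μm μp : ℝ} {T : EReal} {η₀ u₀ : ℝ → ℝ}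
    {η u : ℝ → L2 (univ : Set ℝ)} (h : IsHybridSolution μm μp T η₀ u₀ η u) :
    ∀ᵐ t ∂(volume.restrict (timeInterval T)), ∃ a b, HasInterfaceTraces univ (u t) a b := by
  obtain ⟨-, -, -, -, ux, uxx, hH, -⟩ := h
  filter_upwards [hH.weakDeriv_u, hH.weakDeriv_ux] with t h1 h2
  exact exists_hasInterfaceTraces_of_hasWeakDeriv h1 h2

theorem mainTheorem5 (T : EReal) (hT : 0 < T) (μm μp : ℝ) (hμm : 0 ≤ μm) (hμp : 0 ≤ μp)
    (η₀ u₀ : ℝ → ℝ)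
    (η u : ℝ → L2 (univ : Set ℝ)) (ηm um : ℝ → L2 (Iio 0)) (ηp up : ℝ → L2 (Ioi 0))
    (hW : IsHybridSolution μm μp T η₀ u₀ η u)
    (hWm : IsHomogeneousSolution (Iio 0) μm T η₀ u₀ ηm um)
    (hWp : IsHomogeneousSolution (Ioi 0) μp T η₀ u₀ ηp up)
    (gm dm gp dp : ℝ → ℝ)
    (htrm : ∀ᵐ t ∂(volume.restrict (timeInterval T)),
      HasInterfaceTraces (Iio 0) (um t) (gm t) (dm t))
    (htrp : ∀ᵐ t ∂(volume.restrict (timeInterval T)),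
      HasInterfaceTraces (Ioi 0) (up t) (gp t) (dp t))
    (hLgm : HasLaplaceTransform T gm) (hLgp : HasLaplaceTransform T gp)
    (hLdm : HasLaplaceTransform T dm) (hLdp : HasLaplaceTransform T dp) :
    ((∀ t ∈ timeIntervalZero T,
        ηm t =ᵐ[volume.restrict (Iio 0)] η t ∧ um t =ᵐ[volume.restrict (Iio 0)] u t) ∧
      (∀ t ∈ timeIntervalZero T,
        ηp t =ᵐ[volume.restrict (Ioi 0)] η t ∧ up t =ᵐ[volume.restrict (Ioi 0)] u t)) ↔
    ((∀ᵐ t ∂(volume.restrict (timeInterval T)), gm t = gp t) ∧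
      (∀ᵐ t ∂(volume.restrict (timeInterval T)), dm t = dp t)) := by
  have htr := hW.ae_exists_hasInterfaceTraces
  constructor
  · rintro ⟨hm, hp⟩
    have key : ∀ᵐ t ∂(volume.restrict (timeInterval T)), gm t = gp t ∧ dm t = dp t := by
      filter_upwards [htr, htrm, htrp, ae_restrict_mem (isOpen_timeInterval T).measurableSet]
        with t ⟨a, b, hab⟩ h1 h2 ht
      have ht' := timeInterval_subset_timeIntervalZero T ht
      have e1 := (h1.congr (hm t ht').2).unique isOpen_Iio (by simp) (hab.mono (subset_univ _))
      have e2 := (h2.congr (hp t ht').2).unique isOpen_Ioi (by simp) (hab.mono (subset_univ _))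
      exact ⟨e1.1.trans e2.1.symm, e1.2.trans e2.2.symm⟩
    exact ⟨key.mono fun _ h => h.1, key.mono fun _ h => h.2⟩
  · rintro ⟨hg, hd⟩
    obtain ⟨wmx, wmxx, hm⟩ := hWm.sub isOpen_Iio hW.restrict_Iio
    obtain ⟨wpx, wpxx, hp⟩ := hWp.sub isOpen_Ioi hW.restrict_Ioi
    have htraces : ∀ᵐ t ∂(volume.restrict (timeInterval T)), ∃ a b,
        HasInterfaceTraces (Iio 0) (um t - restrictL2 (subset_univ _) (u t) : L2 (Iio 0)) a b ∧
        HasInterfaceTraces (Ioi 0) (up t - restrictL2 (subset_univ _) (u t) : L2 (Ioi 0)) a b := by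
      filter_upwards [htr, htrm, htrp, hg, hd] with t ⟨a, b, hab⟩ h1 h2 hgt hdt
      -- The hybrid traces `a` and `b` serve both sides, so the equalities `hgt` and `hdt` pass to
      -- the differences.
      refine ⟨gm t - a, dm t - b, ?_, ?_⟩
      · exact (h1.sub ((hab.mono (subset_univ _)).congr (restrictL2_ae_eq _ _).symm)).congr
          (Lp.coeFn_sub _ _).symm
      · rw [hgt, hdt]
        exact (h2.sub ((hab.mono (subset_univ _)).congr (restrictL2_ae_eq _ _).symm)).congr
          (Lp.coeFn_sub _ _).symm
    have key := fun t (ht : t ∈ timeIntervalZero T) =>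
      IsNullSolution.eq_zero_of_traces_eq (sq_nonneg μm) (sq_nonneg μp) hm hp htraces ht
    refine ⟨fun t ht => ?_, fun t ht => ?_⟩
    · obtain ⟨⟨h1, h2⟩, -⟩ := key t ht
      rw [sub_eq_zero.1 h1, sub_eq_zero.1 h2]
      exact ⟨restrictL2_ae_eq _ _, restrictL2_ae_eq _ _⟩
    · obtain ⟨-, h1, h2⟩ := key t ht
      rw [sub_eq_zero.1 h1, sub_eq_zero.1 h2]
      exact ⟨restrictL2_ae_eq _ _, restrictL2_ae_eq _ _⟩
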